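/- **Proposition 3.6.** Let $T$ be a complete first-order theory in a language $\mathcal L$, let $\kappa$ be an infinite cardinal, and let $\mathcal M$ be a $\kappa^+$-saturated model of $T$ (for example a monster model in which sets of size $\kappa$ are small). All tuples and sets below are from $\mathcal M$, consistency and implication are modulo the elementary diagram of $\mathcal M$, and formulas $\varphi(x,y)$ are $\mathcal L$-formulas with $x,y$ finite tuples of variables. *Definitions.* A formula $\varphi(x,y)$ has TP$_2$ in $T$ if in some model of $T$ there are tuples $a^i_j$ ($i,j<\omega$) such that for every $i$ the formulas $\varphi(x,a^i_j)$, $j<\omega$, are pairwise inconsistent, while $\{\varphi(x,a^i_{f(i)})\mid i<\omega\}$ is consistent for every $f\in\omega^\omega$; $T$ has TP$_2$ if some formula has TP$_2$ in $T$. A formula $\varphi(x,b)$ *divides* over $A$ if $\{\varphi(x,a_i)\mid i<\omega\}$ is inconsistent for some $A$-indiscernible sequence $(a_i)_{i<\omega}$ with $a_0=b$; a formula *forks* over $A$ if it implies a finite disjunction of formulas each of which divides over $A$; a type forks over $A$ if it implies a formula that forks over $A$. A *Morley sequence* over $A$ is an $A$-indiscernible sequence $(a_i)_{i<\omega}$ such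 that $\mathrm{tp}(a_i/A\cup\{a_j\mid j<i\})$ does not fork over $A$ for each $i<\omega$. A formula $\varphi(x,b)$ *Kim-divides* over $A$ if $\{\varphi(x,a_i)\mid i<\omega\}$ is inconsistent for some Morley sequence $(a_i)_{i<\omega}$ over $A$ with $a_0=b$; *Kim-forking* of formulas and of types is obtained from Kim-dividing as forking is from dividing. Write $d\not\perp^K_A B$ if $\mathrm{tp}(d/A\cup B)$ Kim-forks over $A$. A sequence $(A_i)_{i<\kappa}$ of sets is *increasing* if $A_i\subsetneq A_j$ for $i<j<\kappa$, and *continuous* if $A_\delta=\bigcup_{i<\delta}A_i$ for every nonzero limit ordinal $\delta<\kappa$. Assume that $T$ has TP$_2$. Then: 1. There are a finite tuple $d$ and an increasing sequence $(A_i)_{i<\kappa}$ of sets with $|A_i|=\max(|i|,\aleph_0)$ and $d\not\perp^K_{A_i}A_{i+1}$ for each $i<\kappa$. If $\kappa>\aleph_0$, this sequence is not continuous, and $|A_i|<\kappa$ for each $i<\kappa$. In particular (with the same $d$) there is an increasing sequence $(B_i)_{i<\omega}$ of countable sets with $d\not\perp^K_{B_i}B_{i+1}$ for each $i<\omega$.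 2. There are a finite tuple $d$ and an increasing continuous sequence $(E_i)_{i<\kappa}$ of sets with $|E_i|=\kappa$ and $d\not\perp^K_{E_i}E_{i+1}$ for each $i<\kappa$. -/

import Mathlib

open FirstOrder Cardinal

universe u v w

namespace KimForking

/-- A family `{φ(x, a i) | i ∈ ι}` of instances of an `L`-formula is consistent in the structure `M`
(i.e. with its elementary diagram): every finite part of it is satisfied by some tuple of `M`. -/
def ConsistentInstances {L : FirstOrder.Language.{u, v}} {M : Type w} [L.Structure M] {ι : Type*} {n m : ℕ}
    (φ : L.Formula (Fin n ⊕ Fin m)) (a : ι → Fin m → M) : Prop :=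
  ∀ s : Finset ι, ∃ x : Fin n → M, ∀ i ∈ s, φ.Realize (Sum.elim x (a i))

/-- The formula `φ(x, y)` has the tree property of the second kind in the theory `T`: in some model
of `T` there is an array of tuples `a i j` with 2-inconsistent rows and consistent paths. -/
def FormulaHasTP2 {L : FirstOrder.Language.{u, v}} (T : L.Theory) {n m : ℕ}
    (φ : L.Formula (Fin n ⊕ Fin m)) : Prop :=
  ∃ (N : FirstOrder.Language.Theory.ModelType.{u, v, max u v} T) (a : ℕ → ℕ → Fin m → N),
    (∀ i j j' : ℕ, j ≠ j' →
      ¬ ∃ x : Fin n → N, φ.Realize (Sum.elim x (a i j)) ∧ φ.Realize (Sum.elim x (a i j'))) ∧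
    ∀ f : ℕ → ℕ, ConsistentInstances φ (fun i => a i (f i))

/-- The theory `T` has TP₂: some `L`-formula has TP₂ in `T`. -/
def HasTP2 {L : FirstOrder.Language.{u, v}} (T : L.Theory) : Prop :=
  ∃ (n m : ℕ) (φ : L.Formula (Fin n ⊕ Fin m)), FormulaHasTP2 T φ

section Structures

variable (L : FirstOrder.Language.{u, v}) {M : Type w} [L.Structure M]

/-- `M` is `μ`-saturated: for every `A ⊆ M` with `|A| < μ`, each set of formulas over `A` in finitely
many variables which is finitely satisfiable in `M` is realized in `M`. -/
def IsSaturated (M : Type w) [L.Structure M] (μ : Cardinal.{w}) : Prop :=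
  ∀ A : Set M, #A < μ → ∀ (n : ℕ) (p : Set (L[[A]].Formula (Fin n))),
    (∀ p₀ : Finset (L[[A]].Formula (Fin n)), (p₀ : Set (L[[A]].Formula (Fin n))) ⊆ p →
      ∃ x : Fin n → M, ∀ θ ∈ p₀, θ.Realize x) →
    ∃ x : Fin n → M, ∀ θ ∈ p, θ.Realize x

/-- The complete type `tp(d/B)`, as a set of formulas over `B`. -/
def tp {n : ℕ} (d : Fin n → M) (B : Set M) : Set (L[[B]].Formula (Fin n)) :=
  {θ | θ.Realize d}

/-- The sequence of `m`-tuples `a 0, a 1, …` is indiscernible over `A`. -/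
def IsIndiscernible (A : Set M) {m : ℕ} (a : ℕ → Fin m → M) : Prop :=
  ∀ (k : ℕ) (θ : L[[A]].Formula (Fin k × Fin m)) (s t : Fin k → ℕ), StrictMono s → StrictMono t →
    (θ.Realize (fun q => a (s q.1) q.2) ↔ θ.Realize (fun q => a (t q.1) q.2))

variable {L}

/-- A set of formulas `p(x)` over `B` implies the formula `φ(x, b)`
(modulo the elementary diagram of `M`): finitely many members of `p` do. -/
def TypeImplies {B : Set M} {n m : ℕ} (p : Set (L[[B]].Formula (Fin n)))
    (φ : L.Formula (Fin n ⊕ Fin m)) (b : Fin m → M) : Prop :=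
  ∃ p₀ : Finset (L[[B]].Formula (Fin n)), (p₀ : Set (L[[B]].Formula (Fin n))) ⊆ p ∧
    ∀ x : Fin n → M, (∀ θ ∈ p₀, θ.Realize x) → φ.Realize (Sum.elim x b)

/-- The formula `φ(x, b)` divides over `A`. -/
def Divides (A : Set M) {n m : ℕ} (φ : L.Formula (Fin n ⊕ Fin m)) (b : Fin m → M) : Prop :=
  ∃ a : ℕ → Fin m → M, a 0 = b ∧ IsIndiscernible L A a ∧ ¬ ConsistentInstances φ a

/-- The formula `φ(x, b)` forks over `A`: it implies a finite disjunction of formulas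
`ψ i (x, c i)`, each of which divides over `A`. -/
def Forks (A : Set M) {n m : ℕ} (φ : L.Formula (Fin n ⊕ Fin m)) (b : Fin m → M) : Prop :=
  ∃ (k : ℕ) (l : Fin k → ℕ) (ψ : ∀ i, L.Formula (Fin n ⊕ Fin (l i))) (c : ∀ i, Fin (l i) → M),
    (∀ i, Divides A (ψ i) (c i)) ∧
    ∀ x : Fin n → M, φ.Realize (Sum.elim x b) → ∃ i, (ψ i).Realize (Sum.elim x (c i))

/-- A set of formulas over `B` forks over `A`: it implies a formula which forks over `A`. -/
def TypeForks (A : Set M) {B : Set M} {n : ℕ} (p : Set (L[[B]].Formula (Fin n))) : Prop :=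
  ∃ (m : ℕ) (φ : L.Formula (Fin n ⊕ Fin m)) (b : Fin m → M), TypeImplies p φ b ∧ Forks A φ b

variable (L)

/-- `d` is (forking-)independent from `B` over `A`: `tp(d/AB)` does not fork over `A`. -/
def Indep {n : ℕ} (d : Fin n → M) (A B : Set M) : Prop :=
  ¬ TypeForks A (tp L d (A ∪ B))

/-- The `A`-indiscernible sequence `a` is a Morley sequence over `A`:
each `a i` is independent from `{a j | j < i}` over `A`. -/
def IsMorley (A : Set M) {m : ℕ} (a : ℕ → Fin m → M) : Prop :=
  IsIndiscernible L A a ∧ ∀ i : ℕ, Indep L (a i) A {e | ∃ j < i, ∃ r, a j r = e}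

variable {L}

/-- The formula `φ(x, b)` Kim-divides over `A`. -/
def KimDivides (A : Set M) {n m : ℕ} (φ : L.Formula (Fin n ⊕ Fin m)) (b : Fin m → M) : Prop :=
  ∃ a : ℕ → Fin m → M, a 0 = b ∧ IsMorley L A a ∧ ¬ ConsistentInstances φ a

/-- The formula `φ(x, b)` Kim-forks over `A`: it implies a finite disjunction of formulas
`ψ i (x, c i)`, each of which Kim-divides over `A`. -/
def KimForks (A : Set M) {n m : ℕ} (φ : L.Formula (Fin n ⊕ Fin m)) (b : Fin m → M) : Prop :=
  ∃ (k : ℕ) (l : Fin k → ℕ) (ψ : ∀ i, L.Formula (Fin n ⊕ Fin (l i))) (c : ∀ i, Fin (l i) → M),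
    (∀ i, KimDivides A (ψ i) (c i)) ∧
    ∀ x : Fin n → M, φ.Realize (Sum.elim x b) → ∃ i, (ψ i).Realize (Sum.elim x (c i))

/-- A set of formulas over `B` Kim-forks over `A`: it implies a formula which Kim-forks over `A`. -/
def TypeKimForks (A : Set M) {B : Set M} {n : ℕ} (p : Set (L[[B]].Formula (Fin n))) : Prop :=
  ∃ (m : ℕ) (φ : L.Formula (Fin n ⊕ Fin m)) (b : Fin m → M), TypeImplies p φ b ∧ KimForks A φ b

variable (L)

/-- `d` is Kim-independent from `B` over `A`: `tp(d/AB)` does not Kim-fork over `A`. -/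
def KimIndep {n : ℕ} (d : Fin n → M) (A B : Set M) : Prop :=
  ¬ TypeKimForks A (tp L d (A ∪ B))

end Structures

/-- The sequence of sets `A i` (`i < κ`) is continuous: `A δ = ⋃_{i < δ} A i` for all (nonzero) limit
ordinals `δ < κ`. -/
def IsContinuousSeq {M : Type w} (κ : Cardinal.{w}) (A : Ordinal.{w} → Set M) : Prop :=
  ∀ δ < κ.ord, Order.IsSuccLimit δ → A δ = ⋃ i ∈ Set.Iio δ, A i

end KimForking

namespace KimForking

open FirstOrder.Language Filter

/-! Saturation stretches a TP₂ array to an array `b` with `κ` rows. Fix a nonprincipal ultrafilter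
`U` on `ℕ` and a set `B` of size `κ` containing the array, and choose recursively `c k` realizing
the `U`-average of row `k` over `B` and the earlier `c j`.

Let `A` contain row `k` and lie inside `B` together with the earlier `c j`. The average type of the
row is finitely satisfiable in `A`, and iterating it from `c k` gives a Morley sequence over `A`.
Pairwise inconsistency of the row passes to this sequence, so `φ(x, c k)` Kim-divides over `A`
(`IsSaturated.kimDivides_of_realizesAverage`). Consistency of all paths passes to the branch
(`consistentInstances_of_realizesAverage`), so a single `d` satisfies every `φ(x, c k)`.

It remains to arrange chains in which row `k` is present one stage before `c k` enters. Feeding in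
rows along with the branch keeps the sets small but breaks continuity at limits; putting all of `B`
in at the start gives continuity at the price of size `κ`. -/

/-- Dependent choice along a well-order. -/
theorem exists_forall_of_forall_exists_Iio {K X : Type*} [LinearOrder K] [WellFoundedLT K]
    (Q : ∀ k : K, (Set.Iio k → X) → X → Prop) (h : ∀ k g, ∃ x, Q k g x) :
    ∃ c : K → X, ∀ k, Q k (fun j => c j) (c k) := by
  choose G hG using h
  let c : K → X := WellFounded.fix (C := fun _ => X) (wellFounded_lt (α := K))
    fun i g => G i fun j => g j j.2
  have hc (k : K) : c k = G k fun j => c j := WellFounded.fix_eq _ _ _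
  refine ⟨c, fun k => ?_⟩
  rw [hc k]
  exact hG k _

/-! ### Saturation: realizing partial types in at most `κ` variables. -/

section Saturation

variable {L : FirstOrder.Language.{u, v}} {M : Type w} [L.Structure M] {κ : Cardinal.{w}}

/-- Turn the variables indexed by a parameter set into constants. -/
def withParameters {A : Set M} {α : Type*} (θ : L.Formula (A ⊕ α)) : L[[A]].Formula α :=
  BoundedFormula.constantsVarsEquiv.symm θ

/-- Turn the constants for parameters into variables. -/
def withoutParameters {A : Set M} {α : Type*} (θ : L[[A]].Formula α) : L.Formula (A ⊕ α) :=
  BoundedFormula.constantsVarsEquiv θ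

theorem realize_withoutParameters {A : Set M} {α : Type*} (θ : L[[A]].Formula α) (x : α → M) :
    (withoutParameters θ).Realize (Sum.elim (fun a : A => (a : M)) x) ↔ θ.Realize x :=
  BoundedFormula.realize_constantsVarsEquiv (M := M)

theorem realize_withParameters {A : Set M} {α : Type*} (θ : L.Formula (A ⊕ α)) (x : α → M) :
    (withParameters θ).Realize x ↔ θ.Realize (Sum.elim (fun a : A => (a : M)) x) := by
  rw [← realize_withoutParameters]
  simp [withParameters, withoutParameters]

/-- The conjunction of a finite set of formulas. -/
noncomputable def conj {α : Type*} (s : Finset (L.Formula α)) : L.Formula α :=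
  Formula.iInf fun θ : s => (θ : L.Formula α)

theorem realize_conj {α : Type*} {N : Type*} [L.Structure N] (s : Finset (L.Formula α))
    (x : α → N) : (conj s).Realize x ↔ ∀ θ ∈ s, θ.Realize x := by
  simp [conj, Formula.realize_iInf]

theorem IsSaturated.exists_realize (hM : IsSaturated L M (Order.succ κ)) {A : Set M} (hA : #A ≤ κ)
    {n : ℕ} (p : Set (L.Formula (A ⊕ Fin n)))
    (hp : ∀ p₀ : Finset (L.Formula (A ⊕ Fin n)), (p₀ : Set (L.Formula (A ⊕ Fin n))) ⊆ p →
      ∃ x : Fin n → M, ∀ θ ∈ p₀, θ.Realize (Sum.elim (fun a : A => (a : M)) x)) :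
    ∃ x : Fin n → M, ∀ θ ∈ p, θ.Realize (Sum.elim (fun a : A => (a : M)) x) := by
  classical
  obtain ⟨x, hx⟩ := hM A (Order.lt_succ_iff.2 hA) n {θ | withoutParameters θ ∈ p} (by
    intro p₀ hp₀
    obtain ⟨x, hx⟩ := hp (p₀.image withoutParameters) (by
      intro θ hθ
      obtain ⟨θ', h, rfl⟩ := Finset.mem_image.1 hθ
      exact hp₀ h)
    exact ⟨x, fun θ hθ => (realize_withoutParameters θ x).1
      (hx _ (Finset.mem_image_of_mem _ hθ))⟩)
  refine ⟨x, fun θ hθ => (realize_withParameters θ x).1 (hx _ ?_)⟩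
  simpa [withParameters, withoutParameters] using hθ

/-- In a `κ⁺`-saturated structure, a family of at most `κ` tuples which is finitely consistent for
`φ` has a common solution. -/
theorem IsSaturated.exists_realize_instances (hM : IsSaturated L M (Order.succ κ))
    (hκ : ℵ₀ ≤ κ) {K : Type w} (hK : #K ≤ κ) {n m : ℕ} {φ : L.Formula (Fin n ⊕ Fin m)}
    {a : K → Fin m → M} (ha : ConsistentInstances φ a) :
    ∃ x : Fin n → M, ∀ i, φ.Realize (Sum.elim x (a i)) := by
  classical
  set A : Set M := Set.range fun p : K × Fin m => a p.1 p.2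
  have hA : #A ≤ κ := by
    refine mk_range_le.trans ?_
    rw [mk_prod, lift_uzero, mk_fin, lift_natCast]
    exact mul_le_of_le hκ hK ((natCast_lt_aleph0 (n := m)).le.trans hκ)
  let ψ (i : K) : L.Formula (A ⊕ Fin n) :=
    φ.relabel (Sum.elim Sum.inr fun q => Sum.inl ⟨a i q, ⟨(i, q), rfl⟩⟩)
  have hψ (i : K) (x : Fin n → M) :
      (ψ i).Realize (Sum.elim (fun a : A => (a : M)) x) ↔ φ.Realize (Sum.elim x (a i)) := by
    simp only [ψ, Formula.realize_relabel]
    apply iff_of_eq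
    congr 1
    ext (q | q) <;> rfl
  obtain ⟨x, hx⟩ := hM.exists_realize hA (Set.range ψ) (by
    intro p₀ hp₀
    obtain ⟨s, rfl⟩ : ∃ s : Finset K, s.image ψ = p₀ := by
      obtain ⟨s, -, h⟩ := Finset.subset_set_image_iff.1 (hp₀.trans Set.image_univ.symm.subset)
      exact ⟨s, h⟩
    obtain ⟨x, hx⟩ := ha s
    refine ⟨x, fun θ hθ => ?_⟩
    obtain ⟨i, hi, rfl⟩ := Finset.mem_image.1 hθ
    exact (hψ i x).2 (hx i hi))
  exact ⟨x, fun i => (hψ i x).1 (hx _ ⟨i, rfl⟩)⟩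

/-- One-variable extension step: if finitely many formulas hold eventually, so does the existential
closure of their conjunction. Hence `g` satisfies it, and the type to be realized is finitely
satisfiable over `g`. -/
theorem IsSaturated.exists_next (hM : IsSaturated L M (Order.succ κ)) {J : Type w} (hJ : #J ≤ κ)
    {Ω N : Type*} [L.Structure N] (F : Filter Ω) (v : Ω → J → N) (y : Ω → N) (g : J → M)
    (hg : ∀ θ : L.Formula J, (∀ᶠ ω in F, θ.Realize (v ω)) → θ.Realize g) :
    ∃ x : M, ∀ θ : L.Formula (J ⊕ Fin 1),
      (∀ᶠ ω in F, θ.Realize (Sum.elim (v ω) fun _ => y ω)) →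
        θ.Realize (Sum.elim g fun _ => x) := by
  classical
  let r : L.Formula (J ⊕ Fin 1) → L.Formula (Set.range g ⊕ Fin 1) := fun θ =>
    θ.relabel (Sum.map (Set.rangeFactorization g) id)
  have hr (θ : L.Formula (J ⊕ Fin 1)) (x : Fin 1 → M) :
      (r θ).Realize (Sum.elim (fun a : Set.range g => (a : M)) x) ↔ θ.Realize (Sum.elim g x) := by
    simp only [r, Formula.realize_relabel]
    apply iff_of_eq
    congr 1
    ext (q | q) <;> rfl
  obtain ⟨x, hx⟩ := hM.exists_realize (mk_range_le.trans hJ)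
    (r '' {θ | ∀ᶠ ω in F, θ.Realize (Sum.elim (v ω) fun _ => y ω)}) (by
    intro p₀ hp₀
    obtain ⟨s, hs, rfl⟩ := Finset.subset_set_image_iff.1 hp₀
    have h1 : ((conj s).iExs (Fin 1)).Realize g := by
      apply hg
      filter_upwards [(Filter.eventually_all_finset s).2 fun θ hθ => hs hθ] with ω hω
      exact Formula.realize_iExs.2 ⟨_, (realize_conj _ _).2 hω⟩
    obtain ⟨x, hx⟩ := Formula.realize_iExs.1 h1
    refine ⟨x, fun θ hθ => ?_⟩
    obtain ⟨θ, hi, rfl⟩ := Finset.mem_image.1 hθ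
    exact (hr θ x).2 ((realize_conj _ _).1 hx θ hi))
  refine ⟨x 0, fun θ hθ => ?_⟩
  convert (hr θ x).1 (hx _ ⟨θ, hθ, rfl⟩) with q

/-- A formula mentions only finitely many variables; this carries the recursion through limit
stages. -/
theorem realize_of_subtype {I : Type*} {N : Type*} [L.Structure N] {Ω : Type*} (F : Filter Ω)
    (v : Ω → I → N) (a : I → M) (S : Set I)
    (h : ∀ s : Finset I, (s : Set I) ⊆ S → ∀ θ : L.Formula s,
      (∀ᶠ ω in F, θ.Realize fun j => v ω j) → θ.Realize fun j => a j)
    (θ : L.Formula S) (hθ : ∀ᶠ ω in F, θ.Realize fun j => v ω j) : θ.Realize fun j => a j := by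
  classical
  let s : Finset I := θ.freeVarFinset.image Subtype.val
  let θ' : L.Formula s :=
    θ.restrictFreeVar fun j => ⟨j, Finset.mem_image_of_mem _ j.2⟩
  refine (BoundedFormula.realize_restrictFreeVar (v := fun j : s => a j) (fun j : S => a j)
    fun _ => rfl).1 (h s ?_ θ' (hθ.mono fun _ hω => ?_))
  · intro j hj
    obtain ⟨j, -, rfl⟩ := Finset.mem_image.1 (Finset.mem_coe.1 hj)
    exact j.2
  · exact (BoundedFormula.realize_restrictFreeVar (v := fun j : s => v _ j)
      (fun j : S => v _ j) fun _ => rfl).2 hω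

/-- Saturation handles finitely many variables at a time, so the variables are well-ordered and
assigned one by one, each over the values already chosen. Sentences have no variable to start from,
hence `h₀`. -/
theorem IsSaturated.exists_realize_of_eventually_aux (hM : IsSaturated L M (Order.succ κ))
    {I : Type w} [LinearOrder I] [WellFoundedLT I] (hI : #I ≤ κ) [Nonempty M]
    {Ω N : Type*} [L.Structure N] (F : Filter Ω) (v : Ω → I → N)
    (h₀ : ∀ θ : L.Formula Empty, (∀ᶠ _ in F, θ.Realize (Empty.elim : Empty → N)) →
      θ.Realize (Empty.elim : Empty → M)) :
    ∃ a : I → M, ∀ θ : L.Formula I, (∀ᶠ ω in F, θ.Realize (v ω)) → θ.Realize a := by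
  classical
  have hJ (i : I) : #(Set.Iio i) ≤ κ := (mk_set_le _).trans hI
  have step (i : I) (g : Set.Iio i → M) : ∃ x : M,
      (∀ θ : L.Formula (Set.Iio i), (∀ᶠ ω in F, θ.Realize fun j => v ω j) → θ.Realize g) →
      ∀ θ : L.Formula (Set.Iio i ⊕ Fin 1),
        (∀ᶠ ω in F, θ.Realize (Sum.elim (fun j => v ω j) fun _ => v ω i)) →
          θ.Realize (Sum.elim g fun _ => x) := by
    by_cases hg : ∀ θ : L.Formula (Set.Iio i),
        (∀ᶠ ω in F, θ.Realize fun j => v ω j) → θ.Realize g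
    · obtain ⟨x, hx⟩ := hM.exists_next (hJ i) F (fun ω j => v ω j) (fun ω => v ω i) g hg
      exact ⟨x, fun _ => hx⟩
    -- The requirement on `x` is conditional on `g` being good, so a bad `g` may take a default
    -- value and the recursion is total.
    · exact ⟨Classical.arbitrary M, fun h => absurd h hg⟩
  obtain ⟨a, hG⟩ := exists_forall_of_forall_exists_Iio _ step
  have hfin (S : Set I) (hS : ∀ i ∈ S, ∀ θ : L.Formula (Set.Iic i),
      (∀ᶠ ω in F, θ.Realize fun j => v ω j) → θ.Realize fun j => a j) (s : Finset I)
      (hs : (s : Set I) ⊆ S) (θ : L.Formula s) (hθ : ∀ᶠ ω in F, θ.Realize fun j => v ω j) :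
      θ.Realize fun j => a j := by
    rcases s.eq_empty_or_nonempty with rfl | hne
    · have e : ∀ j : (∅ : Finset I), False := fun j => Finset.notMem_empty _ j.2
      have key := h₀ (θ.relabel fun j => (e j).elim) (hθ.mono fun ω hω => by
        rw [Formula.realize_relabel]
        convert hω using 1
        ext j
        exact (e j).elim)
      rw [Formula.realize_relabel] at key
      convert key using 1
      ext j
      exact (e j).elim
    -- The variables of a nonempty `s` all lie in the initial segment up to its maximum.
    · have key := hS _ (hs (s.max'_mem hne))
        (θ.relabel fun j : s => (⟨(j : I), s.le_max' _ j.2⟩ : Set.Iic (s.max' hne))) (hθ.mono fun ω hω => by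
          rw [Formula.realize_relabel]
          exact hω)
      rw [Formula.realize_relabel] at key
      exact key
  have main (i : I) : ∀ θ : L.Formula (Set.Iic i),
      (∀ᶠ ω in F, θ.Realize fun j => v ω j) → θ.Realize fun j => a j := by
    induction i using WellFoundedLT.induction with
    | _ i ih =>
      intro θ hθ
      have hlt := realize_of_subtype F v a (Set.Iio i) (hfin _ fun j hj => ih j hj)
      let f : Set.Iic i → Set.Iio i ⊕ Fin 1 := fun j =>
        if h : (j : I) < i then Sum.inl ⟨j, h⟩ else Sum.inr 0
      have key := hG i hlt (θ.relabel f) (hθ.mono fun ω hω => by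
        rw [Formula.realize_relabel]
        convert hω using 1
        ext j
        by_cases h : (j : I) < i
        · simp [f, h]
        · simp [f, le_antisymm j.2 (not_lt.1 h)])
      rw [Formula.realize_relabel] at key
      convert key using 1
      ext j
      by_cases h : (j : I) < i
      · simp [f, h]
      · simp [f, le_antisymm j.2 (not_lt.1 h)]
  refine ⟨a, fun θ hθ => ?_⟩
  have key := realize_of_subtype F v a Set.univ (hfin _ fun j _ => main j)
    (θ.relabel fun i => ⟨i, trivial⟩) (hθ.mono fun ω hω => by
      rw [Formula.realize_relabel]; exact hω)
  rw [Formula.realize_relabel] at key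
  exact key

/-- A partial type in at most `κ` variables which is finitely satisfiable in a model of `T` (along
a filter of assignments) is realized in every `κ⁺`-saturated model of the complete theory `T`. -/
theorem IsSaturated.exists_realize_of_eventually (hM : IsSaturated L M (Order.succ κ))
    {T : L.Theory} (hT : T.IsComplete) [Nonempty M] [T.Model M] {I : Type w} (hI : #I ≤ κ)
    {Ω N : Type*} [L.Structure N] [T.Model N] [Nonempty N] (F : Filter Ω) [F.NeBot]
    (v : Ω → I → N) :
    ∃ a : I → M, ∀ θ : L.Formula I, (∀ᶠ ω in F, θ.Realize (v ω)) → θ.Realize a := by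
  obtain ⟨_, _⟩ := exists_wellFoundedLT I
  refine hM.exists_realize_of_eventually_aux hI F v fun θ hθ => ?_
  obtain ⟨ω, hω⟩ := hθ.exists
  have h1 : N ⊨ (θ : L.Sentence) := by
    rw [Sentence.Realize]
    convert hω
  have h2 : M ⊨ (θ : L.Sentence) :=
    (hT.realize_sentence_iff θ M).2 ((hT.realize_sentence_iff θ N).1 h1)
  rw [Sentence.Realize] at h2
  convert h2

end Saturation

/-! ### Average types along an ultrafilter and their Morley sequences. -/

section Average

variable (L : FirstOrder.Language.{u, v}) {M : Type w} [L.Structure M] {κ : Cardinal.{w}}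

/-- The tuple `c` realizes over `B` the average type of the sequence `b` along the ultrafilter
`U`. -/
def RealizesAverage (U : Ultrafilter ℕ) {m : ℕ} (b : ℕ → Fin m → M) (B : Set M)
    (c : Fin m → M) : Prop :=
  ∀ θ : L.Formula (B ⊕ Fin m), (∀ᶠ j in (U : Filter ℕ),
    θ.Realize (Sum.elim (fun x : B => (x : M)) (b j))) →
      θ.Realize (Sum.elim (fun x : B => (x : M)) c)

variable {L} {U : Ultrafilter ℕ} {m : ℕ} {b : ℕ → Fin m → M} {A B : Set M} {c : Fin m → M}

theorem IsSaturated.exists_realizesAverage (hM : IsSaturated L M (Order.succ κ))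
    (U : Ultrafilter ℕ) (b : ℕ → Fin m → M) (hB : #B ≤ κ) :
    ∃ c, RealizesAverage L U b B c :=
  hM.exists_realize hB _ fun p₀ hp₀ =>
    let ⟨j, hj⟩ := ((Filter.eventually_all_finset p₀).2 fun _ hθ => hp₀ hθ).exists
    ⟨b j, hj⟩

/-- The average type along an ultrafilter is complete: the converse direction is the forward one for
the negation. -/
theorem RealizesAverage.realize_iff (h : RealizesAverage L U b B c) {α : Type*}
    (θ : L.Formula (α ⊕ Fin m)) (e : α → M) (he : ∀ x, e x ∈ B) :
    (∀ᶠ j in (U : Filter ℕ), θ.Realize (Sum.elim e (b j))) ↔ θ.Realize (Sum.elim e c) := by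
  have key (ψ : L.Formula (α ⊕ Fin m)) (y : Fin m → M) :
      (ψ.relabel (Sum.map (fun x => (⟨e x, he x⟩ : B)) id)).Realize
        (Sum.elim (fun x : B => (x : M)) y) ↔ ψ.Realize (Sum.elim e y) := by
    rw [Formula.realize_relabel]
    apply iff_of_eq
    congr 1
    ext (x | x) <;> rfl
  have imp (ψ : L.Formula (α ⊕ Fin m))
      (hψ : ∀ᶠ j in (U : Filter ℕ), ψ.Realize (Sum.elim e (b j))) :
      ψ.Realize (Sum.elim e c) :=
    (key ψ c).1 (h _ (hψ.mono fun j hj => (key ψ _).2 hj))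
  refine ⟨imp θ, fun hc => ?_⟩
  by_contra hn
  rw [← Ultrafilter.eventually_not] at hn
  exact imp θ.not hn hc

theorem RealizesAverage.mono (h : RealizesAverage L U b B c) (hAB : A ⊆ B) :
    RealizesAverage L U b A c := fun θ hθ =>
  (h.realize_iff θ _ fun x => hAB x.2).1 hθ

/-- Otherwise `y = c` is a formula over `B` in the average type, so `b j = c` for `U`-many `j`,
while injectivity allows at most one such `j`. -/
theorem RealizesAverage.exists_notMem (h : RealizesAverage L U b B c)
    (hU : (U : Filter ℕ) ≤ cofinite) (hb : Function.Injective b) : ∃ q, c q ∉ B := by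
  by_contra! hc
  let θ : L.Formula (Fin m ⊕ Fin m) :=
    Formula.iInf fun q : Fin m => Term.equal (Term.var (Sum.inl q)) (Term.var (Sum.inr q))
  have h1 : ∀ᶠ j in (U : Filter ℕ), c = b j := by
    filter_upwards [(h.realize_iff θ c hc).2 (by simp [θ, Formula.realize_iInf])] with j hj
    ext q
    simpa [θ, Formula.realize_iInf] using (Formula.realize_iInf.1 hj) q
  have h2 : ∀ᶠ j in (U : Filter ℕ), c ≠ b j := by
    refine hU ?_
    refine Set.Subsingleton.finite fun i hi j hj => hb ?_
    simp only [Set.mem_compl_iff, Set.mem_ofPred_eq, not_not] at hi hj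
    exact hi.symm.trans hj
  obtain ⟨j, h, h'⟩ := (h1.and h2).exists
  exact h' h

theorem RealizesAverage.realize_withoutParameters_iff (h : RealizesAverage L U b B c)
    (θ : L[[B]].Formula (Fin m)) :
    (∀ᶠ j in (U : Filter ℕ), θ.Realize (b j)) ↔ θ.Realize c := by
  have := h.realize_iff (withoutParameters θ) (fun x : B => (x : M)) fun x => x.2
  simpa only [realize_withoutParameters] using this

/-- A tuple whose type over `A ∪ B` is finitely satisfiable in `A` is independent from `B`
over `A`. -/
theorem indep_of_finitely_satisfiable
    (h : ∀ θ : L[[(A ∪ B : Set M)]].Formula (Fin m), θ.Realize c →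
      ∃ a : Fin m → M, (∀ q, a q ∈ A) ∧ θ.Realize a) : Indep L c A B := by
  rintro ⟨l, φ, d, ⟨p₀, hp₀, himp⟩, k, lk, ψ, e, hdiv, hφ⟩
  obtain ⟨a, haA, ha⟩ := h (conj p₀) ((realize_conj _ _).2 fun θ hθ => hp₀ hθ)
  obtain ⟨i, hi⟩ := hφ a (himp a ((realize_conj _ _).1 ha))
  obtain ⟨s, hs0, hs, hcons⟩ := hdiv i
  refine hcons fun t => ⟨a, fun j _ => ?_⟩
  -- Since `a` lies in `A`, `ψ i (a, y)` is a formula over `A`. Indiscernibility moves its truth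
  -- from `s 0 = e i` to every `s j`, so `a` solves all instances and nothing divides.
  let θ : L[[A]].Formula (Fin 1 × Fin (lk i)) := withParameters
    ((ψ i).relabel (Sum.elim (fun q => Sum.inl ⟨a q, haA q⟩) fun q => Sum.inr (0, q)))
  have hθ (y : Fin 1 × Fin (lk i) → M) :
      θ.Realize y ↔ (ψ i).Realize (Sum.elim a fun q => y (0, q)) := by
    rw [realize_withParameters, Formula.realize_relabel]
    apply iff_of_eq
    congr 1
    ext (x | x) <;> rfl
  have key := hs 1 θ (fun _ => 0) (fun _ => j) (Subsingleton.strictMono _)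
    (Subsingleton.strictMono _)
  rw [hθ, hθ] at key
  exact key.1 (by simpa [hs0] using hi)

/-- The entries of the tuples `c j` with `j < k`. -/
def entriesBelow {K X : Type*} [LT K] {m : ℕ} (c : K → Fin m → X) (k : K) : Set X :=
  {e | ∃ j < k, ∃ r, c j r = e}

theorem mem_entriesBelow {K X : Type*} [LT K] {m : ℕ} {c : K → Fin m → X} {j k : K} (h : j < k)
    (r : Fin m) : c j r ∈ entriesBelow c k :=
  ⟨j, h, r, rfl⟩

/-- A sequence generated by the average type of `b` over `A` is indiscernible over `A`. -/
theorem isIndiscernible_of_realizesAverage (hb : ∀ j q, b j q ∈ A) {c : ℕ → Fin m → M}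
    (hc : ∀ i, RealizesAverage L U b (A ∪ entriesBelow c i) (c i)) : IsIndiscernible L A c := by
  have main (k : ℕ) : ∀ (θ : L.Formula (A ⊕ Fin k × Fin m)) (s t : Fin k → ℕ),
      StrictMono s → StrictMono t →
      (θ.Realize (Sum.elim (fun x : A => (x : M)) fun q => c (s q.1) q.2) ↔
        θ.Realize (Sum.elim (fun x : A => (x : M)) fun q => c (t q.1) q.2)) := by
    induction k with
    | zero =>
      intro θ s t _ _
      rw [Subsingleton.elim s t]
    | succ k ih =>
      intro θ s t hs ht
      -- Separate the last tuple: it realizes the average over everything before it, so it can be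
      -- traded for `b j` with `j` ranging over a `U`-large set.
      let θ₁ : L.Formula ((A ⊕ Fin k × Fin m) ⊕ Fin m) := θ.relabel (Sum.elim (Sum.inl ∘ Sum.inl)
        fun q => Fin.lastCases (motive := fun _ => (A ⊕ Fin k × Fin m) ⊕ Fin m)
          (Sum.inr q.2) (fun i => Sum.inl (Sum.inr (i, q.2))) q.1)
      have h₁ (r : Fin (k + 1) → ℕ) (y : Fin m → M) :
          θ₁.Realize (Sum.elim (Sum.elim (fun x : A => (x : M))
              fun q => c (r (Fin.castSucc q.1)) q.2) y) ↔
            θ.Realize (Sum.elim (fun x : A => (x : M))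
              fun q => Fin.lastCases (motive := fun _ => M) (y q.2)
                (fun i => c (r i.castSucc) q.2) q.1) := by
        rw [Formula.realize_relabel]
        apply iff_of_eq
        congr 1
        ext (x | ⟨i, q⟩)
        · rfl
        · induction i using Fin.lastCases <;> simp
      have h₂ (r : Fin (k + 1) → ℕ) (hr : StrictMono r) :
          θ.Realize (Sum.elim (fun x : A => (x : M)) fun q => c (r q.1) q.2) ↔
            ∀ᶠ j in (U : Filter ℕ), θ₁.Realize (Sum.elim (Sum.elim (fun x : A => (x : M))
              fun q => c (r (Fin.castSucc q.1)) q.2) (b j)) := by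
        rw [(hc (r (Fin.last k))).realize_iff θ₁, h₁]
        · apply iff_of_eq
          congr 2
          ext ⟨i, q⟩
          induction i using Fin.lastCases <;> simp
        · rintro (x | ⟨i, q⟩)
          · exact Or.inl x.2
          · exact Or.inr (mem_entriesBelow (hr (Fin.castSucc_lt_last i)) q)
      rw [h₂ s hs, h₂ t ht]
      refine Filter.eventually_congr (Eventually.of_forall fun j => ?_)
      -- The entries of `b j` lie in `A` and become parameters, leaving a formula in `k` tuples for
      -- the induction hypothesis.
      let θ₂ : L.Formula (A ⊕ Fin k × Fin m) :=
        θ₁.relabel (Sum.elim id fun q => Sum.inl ⟨b j q, hb j q⟩)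
      have h₃ (r : Fin k → ℕ) :
          θ₂.Realize (Sum.elim (fun x : A => (x : M)) fun q => c (r q.1) q.2) ↔
            θ₁.Realize (Sum.elim (Sum.elim (fun x : A => (x : M))
              fun q => c (r q.1) q.2) (b j)) := by
        rw [Formula.realize_relabel]
        apply iff_of_eq
        congr 1
        ext (x | q) <;> rfl
      rw [← h₃ fun i => s i.castSucc, ← h₃ fun i => t i.castSucc]
      exact ih θ₂ _ _ (hs.comp Fin.strictMono_castSucc) (ht.comp Fin.strictMono_castSucc)
  intro k θ s t hs ht
  simpa only [realize_withoutParameters] using main k (withoutParameters θ) s t hs ht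

/-- Whatever holds of `c i` holds of some `b j`, which lies in `A`; finite satisfiability in `A`
gives independence. -/
theorem isMorley_of_realizesAverage (hb : ∀ j q, b j q ∈ A) {c : ℕ → Fin m → M}
    (hc : ∀ i, RealizesAverage L U b (A ∪ entriesBelow c i) (c i)) : IsMorley L A c :=
  ⟨isIndiscernible_of_realizesAverage hb hc, fun i => indep_of_finitely_satisfiable fun θ hθ =>
    let ⟨j, hj⟩ := (((hc i).realize_withoutParameters_iff θ).2 hθ).exists
    ⟨b j, hb j, hj⟩⟩

end Average

/-! ### Common solvability of instances as a formula. -/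

section Solvable

variable {L : FirstOrder.Language.{u, v}} {n m : ℕ}

/-- The formula saying that the instances of `φ` at the tuples indexed by `t` have a common
solution. -/
noncomputable def solvable {ι : Type*} (φ : L.Formula (Fin n ⊕ Fin m)) (t : Finset ι) :
    L.Formula (ι × Fin m) :=
  (Formula.iInf fun i : t => φ.relabel (Sum.elim Sum.inr fun q => Sum.inl ((i : ι), q))).iExs
    (Fin n)

theorem realize_solvable {N : Type*} [L.Structure N] {ι : Type*} (φ : L.Formula (Fin n ⊕ Fin m))
    (t : Finset ι) (y : ι × Fin m → N) :
    (solvable φ t).Realize y ↔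
      ∃ x : Fin n → N, ∀ i ∈ t, φ.Realize (Sum.elim x fun q => y (i, q)) := by
  rw [solvable, Formula.realize_iExs]
  refine exists_congr fun x => ?_
  rw [Formula.realize_iInf, Subtype.forall]
  refine forall_congr' fun i => forall_congr' fun hi => ?_
  rw [Formula.realize_relabel]
  apply iff_of_eq
  congr 1
  ext (q | q) <;> rfl

end Solvable

/-! ### Kim-dividing along averages of inconsistent rows. -/

section KimDividing

variable {L : FirstOrder.Language.{u, v}} {M : Type w} [L.Structure M] {κ : Cardinal.{w}}
  {U : Ultrafilter ℕ} {n m : ℕ} {φ : L.Formula (Fin n ⊕ Fin m)} {b : ℕ → Fin m → M} {A : Set M}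

/-- Unwinding the averages, first of `c'` and then of `c`, reduces the claim to `b i` and `b j` for
`U`-many `i`. A nonprincipal `U` permits `i ≠ j`, where the row is inconsistent. -/
theorem not_exists_realize_of_realizesAverage (hU : (U : Filter ℕ) ≤ cofinite)
    (hφ : ∀ j j', j ≠ j' → ¬ ∃ x : Fin n → M,
      φ.Realize (Sum.elim x (b j)) ∧ φ.Realize (Sum.elim x (b j')))
    {B : Set M} {c c' : Fin m → M} (hb : ∀ j q, b j q ∈ A) (hc : RealizesAverage L U b A c)
    (hc' : RealizesAverage L U b B c') (hcB : ∀ q, c q ∈ B) :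
    ¬ ∃ x : Fin n → M, φ.Realize (Sum.elim x c) ∧ φ.Realize (Sum.elim x c') := by
  let χ : L.Formula (Fin m ⊕ Fin m) := (solvable φ (Finset.univ : Finset Bool)).not.relabel
    fun p => cond p.1 (Sum.inl p.2) (Sum.inr p.2)
  have hχ (y z : Fin m → M) : χ.Realize (Sum.elim y z) ↔
      ¬ ∃ x : Fin n → M, φ.Realize (Sum.elim x y) ∧ φ.Realize (Sum.elim x z) := by
    rw [Formula.realize_relabel, Formula.realize_not, realize_solvable]
    simp [and_comm]
  rw [← hχ, ← hc'.realize_iff χ c hcB]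
  refine Eventually.of_forall fun j => ?_
  let χ' : L.Formula (Fin m ⊕ Fin m) := χ.relabel Sum.swap
  have hχ' (y z : Fin m → M) : χ'.Realize (Sum.elim y z) ↔ χ.Realize (Sum.elim z y) := by
    rw [Formula.realize_relabel]
    apply iff_of_eq
    congr 1
    ext (q | q) <;> rfl
  rw [← hχ', ← hc.realize_iff χ' (b j) (hb j)]
  have : ∀ᶠ i in (U : Filter ℕ), i ≠ j := hU (by simp)
  filter_upwards [this] with i hi
  rw [hχ', hχ]
  exact hφ i j hi

/-- Iterate the average type over `A`, starting from `c`: the result is a Morley sequence whose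
first two instances already clash. -/
theorem IsSaturated.kimDivides_of_realizesAverage (hM : IsSaturated L M (Order.succ κ))
    (hκ : ℵ₀ ≤ κ) (hA : #A ≤ κ) (hU : (U : Filter ℕ) ≤ cofinite)
    (hφ : ∀ j j', j ≠ j' → ¬ ∃ x : Fin n → M,
      φ.Realize (Sum.elim x (b j)) ∧ φ.Realize (Sum.elim x (b j')))
    (hb : ∀ j q, b j q ∈ A) {c : Fin m → M} (hc : RealizesAverage L U b A c) :
    KimDivides A φ c := by
  obtain ⟨s, hs⟩ := exists_forall_of_forall_exists_Iio (K := ℕ) (X := Fin m → M)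
    (fun k g x => RealizesAverage L U b (A ∪ {e | ∃ j, ∃ r, g j r = e}) x ∧ (k = 0 → x = c)) (by
      intro k g
      by_cases hk : k = 0
      · refine ⟨c, ?_, fun _ => rfl⟩
        subst hk
        convert hc
        simp
      · have hcard : #(A ∪ {e | ∃ j, ∃ r, g j r = e} : Set M) ≤ κ := by
          refine (mk_union_le _ _).trans (add_le_of_le hκ hA (le_trans ?_ hκ))
          rw [le_aleph0_iff_set_countable]
          refine (Set.countable_range fun p : Set.Iio k × Fin m => g p.1 p.2).mono ?_
          rintro e ⟨j, r, rfl⟩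
          exact ⟨(j, r), rfl⟩
        obtain ⟨x, hx⟩ := hM.exists_realizesAverage U b hcard
        exact ⟨x, hx, fun h => absurd h hk⟩)
  have hs' (i : ℕ) : RealizesAverage L U b (A ∪ entriesBelow s i) (s i) := by
    convert (hs i).1 using 2
    ext e
    simp [entriesBelow]
  have h0 : s 0 = c := (hs 0).2 rfl
  refine ⟨s, h0, isMorley_of_realizesAverage hb hs', fun hcons => ?_⟩
  obtain ⟨x, hx⟩ := hcons {0, 1}
  exact not_exists_realize_of_realizesAverage hU hφ hb hc (hs' 1)
    (fun q => Or.inr (h0 ▸ mem_entriesBelow one_pos q))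
    ⟨x, h0 ▸ hx 0 (by simp), hx 1 (by simp)⟩

/-- If `tp(d/B)` contains a formula which Kim-divides over `A ⊆ B`, then `d` is Kim-dependent on
`B` over `A`. -/
theorem not_kimIndep_of_kimDivides {B : Set M} {c : Fin m → M} {d : Fin n → M}
    (hc : KimDivides A φ c) (hcB : ∀ q, c q ∈ B) (hd : φ.Realize (Sum.elim d c)) :
    ¬ KimIndep L d A B := by
  classical
  rw [KimIndep, not_not]
  let θ : L[[(A ∪ B : Set M)]].Formula (Fin n) := withParameters
    (φ.relabel (Sum.elim Sum.inr fun q => Sum.inl ⟨c q, Or.inr (hcB q)⟩))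
  have hθ (x : Fin n → M) : θ.Realize x ↔ φ.Realize (Sum.elim x c) := by
    rw [realize_withParameters, Formula.realize_relabel]
    apply iff_of_eq
    congr 1
    ext (q | q) <;> rfl
  refine ⟨m, φ, c, ⟨{θ}, ?_, fun x hx => (hθ x).1 (hx θ (by simp))⟩, 1, fun _ => m, fun _ => φ,
    fun _ => c, fun _ => hc, fun x hx => ⟨0, hx⟩⟩
  rw [Finset.coe_singleton, Set.singleton_subset_iff]
  exact (hθ d).2 hd

end KimDividing

/-! ### The long array and its Kim-dividing branch. -/

section Branch

variable {L : FirstOrder.Language.{u, v}} {M : Type w} [L.Structure M] {κ : Cardinal.{w}}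
  {n m : ℕ} {φ : L.Formula (Fin n ⊕ Fin m)}

/-- A TP₂ array with `κ` many rows exists in every `κ⁺`-saturated model. -/
theorem FormulaHasTP2.exists_array {T : L.Theory} (hφ : FormulaHasTP2 T φ) (hT : T.IsComplete)
    [Nonempty M] [T.Model M] (hM : IsSaturated L M (Order.succ κ)) (hκ : ℵ₀ ≤ κ)
    {K : Type w} (hK : #K ≤ κ) :
    ∃ b : K → ℕ → Fin m → M,
      (∀ k j j', j ≠ j' → ¬ ∃ x : Fin n → M,
        φ.Realize (Sum.elim x (b k j)) ∧ φ.Realize (Sum.elim x (b k j'))) ∧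
      ∀ f : K → ℕ, ConsistentInstances φ fun k => b k (f k) := by
  classical
  obtain ⟨N, a, hrow, hpath⟩ := hφ
  have hI : #((K × ℕ) × Fin m) ≤ κ := by
    simp only [mk_prod, lift_uzero, mk_fin, lift_natCast, mk_nat, lift_aleph0]
    exact mul_le_of_le hκ (mul_le_of_le hκ hK hκ) (natCast_lt_aleph0.le.trans hκ)
  choose e he using fun s : Finset K =>
    Set.countable_iff_exists_injOn.1 s.countable_toSet
  -- At stage `s` the rows in `s` copy distinct rows of the given array. The other rows copy
  -- arbitrary ones, which is harmless: every row is inconsistent, and consistency over `t` is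
  -- needed only once `s ⊇ t`.
  obtain ⟨y, hy⟩ := hM.exists_realize_of_eventually hT hI (N := N) (atTop : Filter (Finset K))
    fun s p => a (e s p.1.1) p.1.2 p.2
  refine ⟨fun k j q => y ((k, j), q), fun k j j' hjj' hx => ?_, fun f t => ?_⟩
  · have h1 := hy (solvable φ {(k, j), (k, j')}).not (Eventually.of_forall fun s => by
      rw [Formula.realize_not, realize_solvable]
      simpa using hrow (e s k) j j' hjj')
    rw [Formula.realize_not, realize_solvable] at h1
    exact h1 (by simpa using hx)
  · have h1 := hy (solvable φ (t.image fun k => (k, f k))) (by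
      filter_upwards [eventually_ge_atTop t] with s hs
      rw [realize_solvable]
      rcases isEmpty_or_nonempty K with hK | hK
      · obtain ⟨x, -⟩ := hpath 0 ∅
        refine ⟨x, fun p _ => (hK.false p.1).elim⟩
      obtain ⟨x, hx⟩ := hpath (fun l => f (Function.invFunOn (e s) s l)) (t.image (e s))
      refine ⟨x, fun p hp => ?_⟩
      obtain ⟨k, hk, rfl⟩ := Finset.mem_image.1 hp
      have := hx (e s k) (Finset.mem_image_of_mem _ hk)
      beta_reduce at this
      rwa [(he s).leftInvOn_invFunOn (hs hk)] at this)
    rw [realize_solvable] at h1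
    obtain ⟨x, hx⟩ := h1
    exact ⟨x, fun k hk => hx _ (Finset.mem_image_of_mem _ hk)⟩

/-- A repeated tuple would make an instance inconsistent with itself, though each instance lies on a
consistent path. -/
theorem injective_of_pairwise_inconsistent {K : Type*} {b : K → ℕ → Fin m → M}
    (hrow : ∀ k j j', j ≠ j' → ¬ ∃ x : Fin n → M,
      φ.Realize (Sum.elim x (b k j)) ∧ φ.Realize (Sum.elim x (b k j')))
    (hpath : ∀ f : K → ℕ, ConsistentInstances φ fun k => b k (f k)) (k : K) :
    Function.Injective (b k) := by
  intro j j' h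
  by_contra hne
  obtain ⟨x, hx⟩ := hpath (fun _ => j) {k}
  have := hx k (by simp)
  exact hrow k j j' hne ⟨x, this, h ▸ this⟩

/-- Replacing each row of an array with consistent paths by a realization of its average type over
the array and the earlier realizations yields a consistent branch. -/
theorem consistentInstances_of_realizesAverage {K : Type*} [LinearOrder K] {U : Ultrafilter ℕ}
    {b : K → ℕ → Fin m → M} {B : Set M} (hB : ∀ k j q, b k j q ∈ B) {c : K → Fin m → M}
    (hc : ∀ k, RealizesAverage L U (b k) (B ∪ entriesBelow c k) (c k))
    (hpath : ∀ f : K → ℕ, ConsistentInstances φ fun k => b k (f k)) :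
    ConsistentInstances φ c := by
  classical
  -- Replace rows one at a time in increasing order, because `c i` is generic only over `B` and the
  -- earlier `c j`.
  have main (s : Finset K) : ∀ f : K → ℕ,
      ConsistentInstances φ fun k => if k ∈ s then c k else b k (f k) := by
    induction s using Finset.induction_on_max with
    | empty => simpa using hpath
    | insert i s hs ih =>
      intro f t
      let θ : L.Formula ((K × Fin m) ⊕ Fin m) := (solvable φ t).relabel
        fun p => if p.1 = i then Sum.inr p.2 else Sum.inl p
      let e : K × Fin m → M := fun p =>
        if p.1 = i then b i 0 p.2 else if p.1 ∈ s then c p.1 p.2 else b p.1 (f p.1) p.2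
      have hθ (y : Fin m → M) : θ.Realize (Sum.elim e y) ↔ ∃ x : Fin n → M, ∀ k ∈ t,
          φ.Realize (Sum.elim x (if k = i then y else if k ∈ s then c k else b k (f k))) := by
        rw [Formula.realize_relabel, realize_solvable]
        refine exists_congr fun x => forall_congr' fun k => forall_congr' fun hk => ?_
        apply iff_of_eq
        congr 2
        ext q
        by_cases h : k = i
        · simp [h]
        · by_cases h' : k ∈ s <;> simp [h, h', e]
      have he (p : K × Fin m) : e p ∈ B ∪ entriesBelow c i := by
        simp only [e]
        split_ifs with h1 h2
        · exact Or.inl (hB _ _ _)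
        · exact Or.inr (mem_entriesBelow (hs _ h2) _)
        · exact Or.inl (hB _ _ _)
      -- Every `b i j` satisfies `θ`, by the induction hypothesis for the path sent through `j` at
      -- row `i`; hence so does `c i`.
      have key := ((hc i).realize_iff θ e he).1 (Eventually.of_forall fun j => by
        rw [hθ]
        obtain ⟨x, hx⟩ := ih (Function.update f i j) t
        refine ⟨x, fun k hk => ?_⟩
        convert hx k hk using 2
        by_cases h : k = i
        · subst h
          have hks : k ∉ s := fun h => lt_irrefl _ (hs k h)
          simp [hks]
        · simp [h])
      obtain ⟨x, hx⟩ := (hθ _).1 key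
      refine ⟨x, fun k hk => ?_⟩
      convert hx k hk using 2
      by_cases h : k = i
      · simp [h]
      · simp [h]
  intro s
  obtain ⟨x, hx⟩ := main s 0 s
  exact ⟨x, fun k hk => by simpa [hk] using hx k hk⟩

/-- If `#M < κ`, all of `M` may serve as parameters, and the finitely satisfiable type of an element
different from each of them would be realized. -/
theorem IsSaturated.le_mk (hM : IsSaturated L M (Order.succ κ)) [Infinite M] : κ ≤ #M := by
  classical
  by_contra! h
  let θ (a : (Set.univ : Set M)) : L.Formula ((Set.univ : Set M) ⊕ Fin 1) :=
    (Term.equal (Term.var (Sum.inl a)) (Term.var (Sum.inr 0))).not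
  have hθ (a) (x : Fin 1 → M) :
      (θ a).Realize (Sum.elim (fun a : (Set.univ : Set M) => (a : M)) x) ↔ (a : M) ≠ x 0 := by
    simp [θ]
  obtain ⟨x, hx⟩ := hM.exists_realize (A := Set.univ) (by simpa using h.le) (Set.range θ) (by
    intro p₀ hp₀
    obtain ⟨s, -, rfl⟩ := Finset.subset_set_image_iff.1 (hp₀.trans Set.image_univ.symm.subset)
    obtain ⟨x, hx⟩ := Infinite.exists_notMem_finset (s.image Subtype.val)
    refine ⟨fun _ => x, fun ψ hψ => ?_⟩
    obtain ⟨a, ha, rfl⟩ := Finset.mem_image.1 hψ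
    exact (hθ a _).2 fun h => hx (h ▸ Finset.mem_image_of_mem _ ha))
  exact (hθ ⟨x 0, trivial⟩ x).1 (hx _ ⟨_, rfl⟩) rfl

theorem mk_entriesBelow_le (hκ : ℵ₀ ≤ κ) {K : Type w} [LT K] (hK : #K ≤ κ) (c : K → Fin m → M)
    (k : K) : #(entriesBelow c k) ≤ κ := by
  refine (mk_le_mk_of_subset (t := Set.range fun p : K × Fin m => c p.1 p.2) ?_).trans ?_
  · rintro e ⟨j, -, r, rfl⟩
    exact ⟨(j, r), rfl⟩
  · refine mk_range_le.trans ?_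
    rw [mk_prod, lift_uzero, mk_fin, lift_natCast]
    exact mul_le_of_le hκ hK (natCast_lt_aleph0.le.trans hκ)

theorem infinite_of_injective_tuples {A : Set M} {b : ℕ → Fin m → M} (hb : Function.Injective b)
    (hA : ∀ j q, b j q ∈ A) : Infinite A := by
  by_contra h
  rw [not_infinite_iff_finite] at h
  refine not_injective_infinite_finite (fun j q => (⟨b j q, hA j q⟩ : A)) fun j j' h => hb ?_
  ext q
  exact congrArg Subtype.val (congrFun h q)

/-- If `T` has TP₂ then every `κ⁺`-saturated model contains an array `b` and a branch `c` of length
`K` all of whose instances are satisfied by one tuple `d`, each instance Kim-dividing over all sets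
between its row of the array and the array together with the earlier part of the branch. -/
theorem HasTP2.exists_kimDividing_branch {T : L.Theory} (hTP : HasTP2 T) (hT : T.IsComplete)
    [Nonempty M] [T.Model M] (hM : IsSaturated L M (Order.succ κ)) (hκ : ℵ₀ ≤ κ)
    {K : Type w} [LinearOrder K] [WellFoundedLT K] [Nonempty K] (hK : #K ≤ κ) :
    ∃ (n m : ℕ) (φ : L.Formula (Fin n ⊕ Fin m)) (d : Fin n → M) (b : K → ℕ → Fin m → M)
      (c : K → Fin m → M) (B : Set M),
      #B = κ ∧ (∀ k j q, b k j q ∈ B) ∧ (∀ k, Function.Injective (b k)) ∧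
      (∀ k, ∃ q, c k q ∉ B ∪ entriesBelow c k) ∧
      (∀ k, φ.Realize (Sum.elim d (c k))) ∧
      ∀ k (A : Set M), (∀ j q, b k j q ∈ A) → A ⊆ B ∪ entriesBelow c k →
        KimDivides A φ (c k) := by
  obtain ⟨n, m, φ, hφ⟩ := hTP
  obtain ⟨b, hrow, hpath⟩ := hφ.exists_array hT hM hκ hK
  have hinj := injective_of_pairwise_inconsistent hrow hpath
  obtain ⟨k₀⟩ := ‹Nonempty K›
  have : Infinite M := Set.infinite_univ_iff.1
    (Set.infinite_coe_iff.1 (infinite_of_injective_tuples (hinj k₀) fun _ _ => trivial))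
  obtain ⟨X, hX⟩ := le_mk_iff_exists_set.1 hM.le_mk
  -- The set `X` pads the array so that `B` has size exactly `κ`.
  let B : Set M := X ∪ Set.range fun p : (K × ℕ) × Fin m => b p.1.1 p.1.2 p.2
  have hB : #B = κ := by
    refine le_antisymm ((mk_union_le _ _).trans (add_le_of_le hκ hX.le (mk_range_le.trans ?_)))
      (hX.ge.trans (mk_le_mk_of_subset Set.subset_union_left))
    simp only [mk_prod, lift_uzero, mk_fin, lift_natCast, mk_nat, lift_aleph0]
    exact mul_le_of_le hκ (mul_le_of_le hκ hK hκ) (natCast_lt_aleph0.le.trans hκ)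
  have hbB (k j q) : b k j q ∈ B := Or.inr ⟨((k, j), q), rfl⟩
  let U : Ultrafilter ℕ := Ultrafilter.of cofinite
  have hU : (U : Filter ℕ) ≤ cofinite := Ultrafilter.of_le _
  have hcard (c : K → Fin m → M) (k : K) : #(B ∪ entriesBelow c k : Set M) ≤ κ :=
    (mk_union_le _ _).trans (add_le_of_le hκ hB.le (mk_entriesBelow_le hκ hK c k))
  obtain ⟨c, hc⟩ := exists_forall_of_forall_exists_Iio (K := K) (X := Fin m → M)
    (fun k g x => RealizesAverage L U (b k) (B ∪ {e | ∃ j, ∃ r, g j r = e}) x) (by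
      intro k g
      have hg : #{e | ∃ j, ∃ r, g j r = e} ≤ κ := by
        refine (mk_le_mk_of_subset
          (t := Set.range fun p : Set.Iio k × Fin m => g p.1 p.2) ?_).trans ?_
        · rintro e ⟨j, r, rfl⟩
          exact ⟨(j, r), rfl⟩
        · refine mk_range_le.trans ?_
          rw [mk_prod, lift_uzero, mk_fin, lift_natCast]
          exact mul_le_of_le hκ ((mk_set_le _).trans hK) (natCast_lt_aleph0.le.trans hκ)
      exact hM.exists_realizesAverage U (b k)
        ((mk_union_le _ _).trans (add_le_of_le hκ hB.le hg)))
  replace hc (k : K) : RealizesAverage L U (b k) (B ∪ entriesBelow c k) (c k) := by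
    convert hc k using 2
    ext e
    simp [entriesBelow]
  obtain ⟨d, hd⟩ := hM.exists_realize_instances hκ hK
    (consistentInstances_of_realizesAverage hbB hc hpath)
  exact ⟨n, m, φ, d, b, c, B, hB, hbB, hinj, fun k => (hc k).exists_notMem hU (hinj k), hd,
    fun k A hbA hA => hM.kimDivides_of_realizesAverage hκ ((mk_le_mk_of_subset hA).trans (hcard c k))
      hU (hrow k) hbA ((hc k).mono hA)⟩

end Branch

/-! ### Initial segments of the array and the branch, with their sizes. -/

section Chains

variable {M : Type w} {κ : Cardinal.{w}} {m : ℕ}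

/-- The position of an element of `o.ToType`. -/
noncomputable def rank {o : Ordinal.{w}} (k : o.ToType) : Ordinal.{w} :=
  Ordinal.typein (α := o.ToType) (· < ·) k

/-- The first `α` many rows of an array `b` of tuples. -/
def rowsBelow {o : Ordinal.{w}} (b : o.ToType → ℕ → Fin m → M) (α : Ordinal.{w}) : Set M :=
  {e | ∃ k, rank k < α ∧ ∃ j q, b k j q = e}

/-- The entries of the first `α` many tuples of a sequence `c`. -/
def initialEntries {o : Ordinal.{w}} (c : o.ToType → Fin m → M) (α : Ordinal.{w}) : Set M :=
  {e | ∃ k, rank k < α ∧ ∃ q, c k q = e}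

theorem rank_lt_rank {o : Ordinal.{w}} {k l : o.ToType} : rank k < rank l ↔ k < l :=
  Ordinal.typein_lt_typein _

theorem rank_lt {o : Ordinal.{w}} (k : o.ToType) : rank k < o :=
  Ordinal.typein_lt_self k

theorem exists_rank_eq {o α : Ordinal.{w}} (h : α < o) : ∃ k : o.ToType, rank k = α :=
  ⟨_, Ordinal.typein_enum (α := o.ToType) (· < ·) (by rwa [Ordinal.type_toType])⟩

theorem rowsBelow_mono {o : Ordinal.{w}} (b : o.ToType → ℕ → Fin m → M) :
    Monotone (rowsBelow b) := fun _ _ h _ ⟨k, hk, he⟩ => ⟨k, hk.trans_le h, he⟩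

theorem initialEntries_mono {o : Ordinal.{w}} (c : o.ToType → Fin m → M) :
    Monotone (initialEntries c) := fun _ _ h _ ⟨k, hk, he⟩ => ⟨k, hk.trans_le h, he⟩

theorem initialEntries_rank {o : Ordinal.{w}} (c : o.ToType → Fin m → M) (k : o.ToType) :
    initialEntries c (rank k) = entriesBelow c k := by
  ext e
  simp only [initialEntries, entriesBelow, rank_lt_rank]

theorem mk_rank_lt {o α : Ordinal.{w}} (h : α < o) : #{k : o.ToType | rank k < α} = α.card := by
  obtain ⟨l, rfl⟩ := exists_rank_eq h
  simp only [rank_lt_rank]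
  exact (Ordinal.card_typein (r := fun x y : o.ToType => x < y) l).symm

theorem mk_rowsBelow_union_initialEntries_le {o α β : Ordinal.{w}} (hα : α < o) (hβ : β < o)
    (b : o.ToType → ℕ → Fin m → M) (c : o.ToType → Fin m → M) :
    #(rowsBelow b α ∪ initialEntries c β : Set M) ≤ max (max α.card β.card) ℵ₀ := by
  have hrows : #(rowsBelow b α) ≤ max α.card ℵ₀ := by
    refine (mk_le_mk_of_subset (t := Set.range
      fun p : ({k : o.ToType | rank k < α} × ℕ) × Fin m => b p.1.1 p.1.2 p.2) ?_).trans ?_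
    · rintro e ⟨k, hk, j, q, rfl⟩
      exact ⟨((⟨k, hk⟩, j), q), rfl⟩
    · refine mk_range_le.trans ?_
      simp only [mk_prod, lift_uzero, mk_fin, lift_natCast, mk_nat, lift_aleph0, mk_rank_lt hα]
      have h := le_max_right α.card ℵ₀
      exact mul_le_of_le h (mul_le_of_le h (le_max_left _ _) h) (natCast_lt_aleph0.le.trans h)
  have hentries : #(initialEntries c β) ≤ max β.card ℵ₀ := by
    refine (mk_le_mk_of_subset (t := Set.range
      fun p : {k : o.ToType | rank k < β} × Fin m => c p.1 p.2) ?_).trans ?_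
    · rintro e ⟨k, hk, q, rfl⟩
      exact ⟨(⟨k, hk⟩, q), rfl⟩
    · refine mk_range_le.trans ?_
      simp only [mk_prod, lift_uzero, mk_fin, lift_natCast, mk_rank_lt hβ]
      have h := le_max_right β.card ℵ₀
      exact mul_le_of_le h (le_max_left _ _) (natCast_lt_aleph0.le.trans h)
  refine (mk_union_le _ _).trans (add_le_of_le (le_max_right _ _) (hrows.trans ?_)
    (hentries.trans ?_))
  · exact max_le_max_right _ (le_max_left _ _)
  · exact max_le_max_right _ (le_max_right _ _)

/-- If each tuple `c k` has an entry outside the earlier tuples, then the first `α` of them have at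
least `|α|` many entries. -/
theorem card_le_mk_initialEntries {o α : Ordinal.{w}} (hα : α < o) (c : o.ToType → Fin m → M)
    (hc : ∀ k, ∃ q, c k q ∉ entriesBelow c k) : α.card ≤ #(initialEntries c α) := by
  choose q hq using hc
  rw [← mk_rank_lt hα]
  refine mk_le_of_injective
    (f := fun k => (⟨c k (q k), k, k.2, q k, rfl⟩ : initialEntries c α)) fun k l h => ?_
  have h' : c k (q k) = c l (q l) := congrArg Subtype.val h
  rcases lt_trichotomy (k : o.ToType) l with hkl | hkl | hkl
  · exact absurd (h' ▸ mem_entriesBelow hkl (q k)) (hq l)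
  · exact Subtype.ext hkl
  · exact absurd (h' ▸ mem_entriesBelow hkl (q l)) (hq k)

end Chains

end KimForking

/-! ### The small chain and the continuous chain. -/

theorem proposition3p6 {L : FirstOrder.Language.{u, v}} (T : L.Theory) (hT : T.IsComplete)
    (hTP : KimForking.HasTP2 T) (κ : Cardinal.{w}) (hκ : ℵ₀ ≤ κ)
    (M : Type w) [L.Structure M] [Nonempty M] [T.Model M]
    (hM : KimForking.IsSaturated L M (Order.succ κ)) :
    (∃ (n : ℕ) (d : Fin n → M),
      (∃ A : Ordinal.{w} → Set M,
        StrictMonoOn A (Set.Iio κ.ord) ∧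
        (ℵ₀ < κ → ¬ KimForking.IsContinuousSeq κ A ∧ ∀ i < κ.ord, #(A i) < κ) ∧
        (∀ i < κ.ord, #(A i) = max i.card ℵ₀) ∧
        ∀ i < κ.ord, ¬ KimForking.KimIndep L d (A i) (A (i + 1))) ∧
      (∃ B : ℕ → Set M,
        StrictMono B ∧ (∀ i, (B i).Countable) ∧
        ∀ i, ¬ KimForking.KimIndep L d (B i) (B (i + 1)))) ∧
    (∃ (n : ℕ) (d : Fin n → M) (E : Ordinal.{w} → Set M),
      StrictMonoOn E (Set.Iio κ.ord) ∧
      KimForking.IsContinuousSeq κ E ∧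
      (∀ i < κ.ord, #(E i) = κ) ∧
      ∀ i < κ.ord, ¬ KimForking.KimIndep L d (E i) (E (i + 1))) := by
  open KimForking in
  have hlim : Order.IsSuccLimit κ.ord := isSuccLimit_ord hκ
  have hsucc {α : Ordinal.{w}} (h : α < κ.ord) : α + 1 < κ.ord := by
    simpa using hlim.succ_lt h
  have : Nonempty κ.ord.ToType := by
    rw [Ordinal.nonempty_toType_iff]
    exact hlim.ne_bot
  obtain ⟨n, m, φ, d, b, c, B, hB, hbB, hinj, hc, hd, hdiv⟩ :=
    hTP.exists_kimDividing_branch hT hM hκ (K := κ.ord.ToType) (mk_ord_toType κ).le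
  have hfresh (k : κ.ord.ToType) : ∃ q, c k q ∉ B ∪ initialEntries c (rank k) := by
    simpa only [initialEntries_rank] using hc k
  have hrows (α) : rowsBelow b α ⊆ B := by
    rintro e ⟨k, -, j, q, rfl⟩
    exact hbB k j q
  -- the first sequence
  let A : Ordinal.{w} → Set M := fun α => rowsBelow b (α + 2) ∪ initialEntries c (α + 1)
  have hAmono : Monotone A := fun α β h => Set.union_subset_union
    (rowsBelow_mono b (by gcongr)) (initialEntries_mono c (by gcongr))
  have hAsub (α) : A α ⊆ B ∪ initialEntries c (α + 1) :=
    Set.union_subset_union_left _ (hrows _)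
  have hAnew (k : κ.ord.ToType) {α} (h : α < rank k) : ¬ A (rank k) ⊆ A α := by
    intro hsub
    obtain ⟨q, hq⟩ := hfresh k
    have h1 : c k q ∈ A (rank k) := Or.inr ⟨k, by simp, q, rfl⟩
    exact hq (Set.union_subset_union_right _
      (initialEntries_mono c (Order.add_one_le_of_lt h)) (hAsub α (hsub h1)))
  have hAstrict : StrictMonoOn A (Set.Iio κ.ord) := by
    intro α _ β hβ h
    obtain ⟨k, rfl⟩ := exists_rank_eq hβ
    exact ⟨hAmono h.le, hAnew k h⟩
  have hAcard (α) (hα : α < κ.ord) : #(A α) = max α.card ℵ₀ := by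
    have h2 : α + 2 = α + 1 + 1 := by rw [add_assoc, one_add_one_eq_two]
    refine le_antisymm ((mk_rowsBelow_union_initialEntries_le
      (h2 ▸ hsucc (hsucc hα)) (hsucc hα) b c).trans ?_) (max_le ?_ ?_)
    · have h (l : ℕ) : α.card + l ≤ max α.card ℵ₀ :=
        add_le_of_le (le_max_right _ _) (le_max_left _ _)
          (natCast_lt_aleph0.le.trans (le_max_right _ _))
      refine max_le (max_le ?_ ?_) (le_max_right _ _)
      · simpa using h 2
      · simpa using h 1
    · refine (card_le_mk_initialEntries hα c fun k => ?_).trans (mk_le_mk_of_subset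
        ((initialEntries_mono c (Order.le_succ α)).trans Set.subset_union_right))
      obtain ⟨q, hq⟩ := hc k
      exact ⟨q, fun h => hq (Or.inr h)⟩
    · obtain ⟨k, rfl⟩ := exists_rank_eq hα
      rw [aleph0_le_mk_iff]
      exact infinite_of_injective_tuples (hinj k)
        fun j q => Or.inl ⟨k, by simp [← one_add_one_eq_two, ← add_assoc], j, q, rfl⟩
  have hAdep (α) (hα : α < κ.ord) : ¬ KimIndep L d (A α) (A (α + 1)) := by
    -- The witness has index `α + 1`: the bound `α + 2` puts its row into `A α`, while its branch
    -- tuple enters only at `A (α + 1)`.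
    obtain ⟨k, hk⟩ := exists_rank_eq (hsucc hα)
    refine not_kimIndep_of_kimDivides (hdiv k (A α)
      (fun j q => Or.inl ⟨k, ?_, j, q, rfl⟩) ?_) (fun q => Or.inr ⟨k, ?_, q, rfl⟩) (hd k)
    · rw [hk]; simp [← one_add_one_eq_two, ← add_assoc]
    · rw [← initialEntries_rank, hk]
      exact hAsub α
    · rw [hk]; simp
  -- Finite ordinals lie below `κ.ord`, so the countable chain is the restriction of `A` to them.
  have hnat (i : ℕ) : (i : Ordinal.{w}) < κ.ord :=
    (Ordinal.natCast_lt_omega0 i).trans_le (by rwa [← ord_aleph0, ord_le_ord])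
  -- the second sequence
  let E : Ordinal.{w} → Set M := fun α => B ∪ initialEntries c α
  have hEmono : Monotone E := fun α β h =>
    Set.union_subset_union_right _ (initialEntries_mono c h)
  refine ⟨⟨n, d, ⟨A, hAstrict, fun hκ' => ⟨fun hcont => ?_, fun α hα => ?_⟩, hAcard, hAdep⟩,
    fun i => A i, fun i j h => hAstrict (hnat i) (hnat j) (by exact_mod_cast h), fun i => ?_,
    fun i => by simpa using hAdep i (hnat i)⟩, n, d, E, ?_, ?_, fun α hα => ?_, fun α hα => ?_⟩
  -- Continuity fails at `ω`: the tuple of index `ω` belongs to `A ω` but has an entry outside every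
  -- earlier `A α`.
  · have hω : Ordinal.omega0 < κ.ord := by rwa [← ord_aleph0, ord_lt_ord]
    obtain ⟨k, hk⟩ := exists_rank_eq hω
    obtain ⟨q, hq⟩ := hfresh k
    have h1 : c k q ∈ A (rank k) := Or.inr ⟨k, by simp, q, rfl⟩
    rw [hk, hcont _ hω Ordinal.isSuccLimit_omega0] at h1
    obtain ⟨α, hα, h1⟩ := Set.mem_iUnion₂.1 h1
    refine hq (Set.union_subset_union_right _ (initialEntries_mono c ?_) (hAsub α h1))
    rw [hk]
    exact Order.add_one_le_of_lt hα
  · rw [hAcard α hα]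
    exact max_lt (lt_ord.1 hα) hκ'
  · rw [← Set.countable_coe_iff, ← mk_le_aleph0_iff, hAcard _ (hnat i)]
    simp [natCast_lt_aleph0.le]
  · intro α hα β _ h
    refine ⟨hEmono h.le, fun hsub => ?_⟩
    obtain ⟨k, rfl⟩ := exists_rank_eq hα
    obtain ⟨q, hq⟩ := hfresh k
    exact hq (hsub (Or.inr ⟨k, h, q, rfl⟩))
  -- All rows are in `B` from the start, and a branch tuple of index below the limit `δ` has entered
  -- by the next stage, still below `δ`.
  · intro δ _ hδ
    refine subset_antisymm ?_ (Set.iUnion₂_subset fun α hα => hEmono (le_of_lt hα))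
    rintro e (he | ⟨k, hk, q, rfl⟩)
    · exact Set.mem_iUnion₂.2 ⟨0, hδ.bot_lt, Or.inl he⟩
    · exact Set.mem_iUnion₂.2 ⟨rank k + 1, hδ.add_one_lt hk, Or.inr ⟨k, by simp, q, rfl⟩⟩
  · refine le_antisymm ((mk_union_le _ _).trans (add_le_of_le hκ hB.le ?_))
      (hB.ge.trans (mk_le_mk_of_subset Set.subset_union_left))
    obtain ⟨k, rfl⟩ := exists_rank_eq hα
    rw [initialEntries_rank]
    exact mk_entriesBelow_le hκ (mk_ord_toType κ).le c k
  · obtain ⟨k, rfl⟩ := exists_rank_eq hα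
    refine not_kimIndep_of_kimDivides (hdiv k (E (rank k))
      (fun j q => Or.inl (hbB k j q)) ?_) (fun q => Or.inr ⟨k, by simp, q, rfl⟩) (hd k)
    rw [← initialEntries_rank]
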